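/- Let $n\ge 1$ be an integer, $h=1/n$, $x_j=j/n$ ($0\le j\le n$), $K_j=(x_{j-1},x_j)$, $\Omega=(0,1)$. For complex-valued functions put $(v,w)=\int_0^1 v\,\bar w\,dx$ and $\|v\|=(v,v)^{1/2}$. Let $$V_h=\{v\in H^1(\Omega):\ v(0)=0,\ v|_{K_j}\text{ is a polynomial of degree at most }1,\ j=1,\dots,n\},$$ and for a piecewise smooth $g$ let $[g]_j=g(x_j-)-g(x_j+)$, $1\le j\le n-1$. For $k>0$ and a penalty parameter $\gamma$ let, for $u,v\in V_h$, $$a_h(u,v)=(u',v')-k^2(u,v)-\mathrm i k\,u(1)\bar v(1)+J(u,v),$$ $$J(u,v)=\sum_{j=1}^{n-1}\gamma h\,[u']_j[\bar v']_j+\gamma h\,\bigl(u'(1)-\mathrm i k\,u(1)\bigr)\bigl(\bar v'(1)-\mathrm i k\,\bar v(1)\bigr),$$ where $u'(1),v'(1)$ are limits from the left, and $$\|v\|_{1,h}=\Bigl(\|v'\|^2+\sum_{j=1}^{n-1}|\gamma|\,h\,\bigl|[v']_j\bigr|^2\Bigr)^{1/2}.$$ **Theorem.** There is an absolute constant $C>0$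 such that for every integer $n\ge1$, all real $k\ge 1$ with $kh\le 1$, all real $\gamma$ with $0<|\gamma|\le\frac16$, and all $f\in L^2(\Omega)$, there is exactly one $u_h\in V_h$ with $$a_h(u_h,v_h)=(f,v_h)\qquad\text{for all }v_h\in V_h,$$ and this solution of the CIP-FEM satisfies $$\|u_h\|_{1,h}\le C\,\|f\|.$$ In particular, $C$ does not depend on $k$, $h$, $\gamma$ or $f$. -/

import Mathlib

open scoped ContDiff

namespace CIP

noncomputable section

open MeasureTheory Set

/-- Lebesgue measure on `Ω = (0,1)`. -/
abbrev vol : Measure ℝ := volume.restrict (Ioo (0 : ℝ) 1)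

/-- The inner product `(v,w) = ∫_Ω v w̄`. -/
def l2Inner (v w : ℝ → ℂ) : ℂ := ∫ x, v x * (starRingEnd ℂ) (w x) ∂vol

/-- The norm `‖w‖ = (∫_Ω |w|²)^{1/2}`. -/
def l2Norm (w : ℝ → ℂ) : ℝ := Real.sqrt (∫ x, ‖w x‖ ^ 2 ∂vol)

/-- `g` is a weak derivative of `v` on `(0,1)`. -/
def IsWeakDeriv (v g : ℝ → ℂ) : Prop :=
  ∀ φ : ℝ → ℂ, ContDiff ℝ ∞ φ → HasCompactSupport φ → tsupport φ ⊆ Ioo (0 : ℝ) 1 →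
    ∫ x, v x * deriv φ x ∂vol = -∫ x, g x * φ x ∂vol

/-- `v ∈ H¹(0,1)`, complex valued. -/
def MemH1 (v : ℝ → ℂ) : Prop :=
  MemLp v 2 vol ∧ ∃ g : ℝ → ℂ, MemLp g 2 vol ∧ IsWeakDeriv v g

/-- The nodes `x_j = j / n` of the uniform mesh with `n` cells. -/
def node (n j : ℕ) : ℝ := (j : ℝ) / n

/-- The mesh size `h = 1 / n`. -/
def meshSize (n : ℕ) : ℝ := 1 / (n : ℝ)

/-- The linear finite element space `V_h`: the `v ∈ H¹(0,1)` (represented by a function that is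
continuous on `[0,1]`; its values outside `[0,1]` are irrelevant) with `v(0) = 0` whose restriction
to each open cell `(x_j, x_{j+1})`, `0 ≤ j < n`, is a polynomial of degree at most one. -/
def femSpace (n : ℕ) : Set (ℝ → ℂ) :=
  {v | MemH1 v ∧ ContinuousOn v (Icc 0 1) ∧ v 0 = 0 ∧
    ∀ j < n, ∃ a b : ℂ, ∀ x ∈ Ioo (node n j) (node n (j + 1)), v x = a + b * (x : ℂ)}

/-- The jump `[g]_j = g(x_j-) - g(x_j+)`. -/
def jump (n : ℕ) (g : ℝ → ℂ) (j : ℕ) : ℂ :=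
  Function.leftLim g (node n j) - Function.rightLim g (node n j)

/-- The value `v'(1)`, that is, the limit of `v'` at `1` from inside `(0,1)`. -/
def derivAtOne (v : ℝ → ℂ) : ℂ := Function.leftLim (deriv v) 1

/-- The penalty form
`J(u,v) = ∑_{j=1}^{n-1} γ h [u']_j [v̄']_j + γ h (u'(1) - i k u(1)) (v̄'(1) - i k v̄(1))`. -/
def penalty (n : ℕ) (k : ℝ) (γ : ℂ) (u v : ℝ → ℂ) : ℂ :=
  (∑ j ∈ Finset.Icc 1 (n - 1),
      γ * (meshSize n : ℂ) * jump n (deriv u) j * (starRingEnd ℂ) (jump n (deriv v) j)) +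
    γ * (meshSize n : ℂ) * (derivAtOne u - Complex.I * (k : ℂ) * u 1) *
      ((starRingEnd ℂ) (derivAtOne v) - Complex.I * (k : ℂ) * (starRingEnd ℂ) (v 1))

/-- The sesquilinear form `a_h(u,v) = (u',v') - k² (u,v) - i k u(1) v̄(1) + J(u,v)`. On functions
that are piecewise smooth on the mesh, the classical derivative (defined off the nodes) is the
weak derivative. -/
def form (n : ℕ) (k : ℝ) (γ : ℂ) (u v : ℝ → ℂ) : ℂ :=
  l2Inner (deriv u) (deriv v) - (k : ℂ) ^ 2 * l2Inner u v
    - Complex.I * (k : ℂ) * u 1 * (starRingEnd ℂ) (v 1) + penalty n k γ u v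

/-- `u_h` solves the CIP-FEM: `u_h ∈ V_h` and `a_h(u_h,v_h) = (f,v_h)` for all `v_h ∈ V_h`. -/
def IsSolution (n : ℕ) (k : ℝ) (γ : ℂ) (f u : ℝ → ℂ) : Prop :=
  u ∈ femSpace n ∧ ∀ v ∈ femSpace n, form n k γ u v = l2Inner f v

/-- `‖v‖_{1,h} = (‖v'‖² + ∑_{j=1}^{n-1} |γ| h |[v']_j|²)^{1/2}`. -/
def energyNorm (n : ℕ) (γ : ℂ) (v : ℝ → ℂ) : ℝ :=
  Real.sqrt (l2Norm (deriv v) ^ 2 +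
    ∑ j ∈ Finset.Icc 1 (n - 1), ‖γ‖ * meshSize n * ‖jump n (deriv v) j‖ ^ 2)

end

end CIP

/-! Write t = kh, let U be the nodal values and Q = DU with D the negative second difference.
Testing with hat functions turns the method into (γD² + (1 + t²/6)D − t²)U = G at the nodes 1, …, n.
Ghost values U(n+1), Q(n+1) are chosen so that all boundary terms cancel and the last row looks like
an interior one.

For |γ| ≤ 1/6 the quadratic has real roots ξ = t²/B and −B/γ with B ≥ 1. Hence dU = Y − W, where Y
and W satisfy second order recurrences and are coupled only at the right end, by a coefficient κ =
O(t²). The root −B/γ has modulus at least 6, so Y is evanescent: it decays geometrically away from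
the right end (`evanescent_growth`). The root ξ ≈ t² makes W a wave with unimodular multipliers z,
z̄.

The two travelling parts of W have equal modulus at the left end, since W 0 = 0, and each modulus
drifts by at most S = ∑ ‖G j‖ (`wave_factor_norm`). The difference of their squares is a flux
(`normSq_sub_normSq_eq_flux`), and the impedance condition forces this flux to be of order t‖W n‖²
up to the data. Therefore t‖W n‖ ≲ S, and all increments of W and Y are O(S) (`coupled_bound`),
uniformly in n, t and γ.

The hat functions sum to at most one, so the loads are summable with total at most ‖f‖; this bounds
the slopes of the solution and with them the energy norm. The same estimate with zero data gives
uniqueness, hence existence in finite dimension. -/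

namespace CIP

/-! ### Stability of the difference scheme: evanescent and travelling parts. -/

/-- A sequence obeying `Y (j+2) = a Y (j+1) - Y j + G j` with `|a| ≥ 4` and `Y 0 = 0` grows by a
factor of at least three, up to the size of the data. -/
theorem evanescent_growth {n : ℕ} {a M : ℝ} {Y G : ℕ → ℂ} (ha : 4 ≤ |a|) (hM : 0 ≤ M)
    (hG : ∀ i < n, ‖G i‖ ≤ M) (h0 : Y 0 = 0)
    (hY : ∀ i < n, Y (i + 2) = a * Y (i + 1) - Y i + G i) :
    ∀ i ≤ n, 3 * ‖Y i‖ ≤ ‖Y (i + 1)‖ + 3 / 2 * M := by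
  intro i
  induction i with
  | zero => intro _; rw [h0, norm_zero]; linarith [norm_nonneg (Y (0 + 1))]
  | succ i ih =>
    intro hi
    have ih := ih (by omega)
    have hY := hY i (by omega)
    have hG := hG i (by omega)
    have h1 : |a| * ‖Y (i + 1)‖ ≤ ‖Y (i + 2)‖ + ‖Y i‖ + ‖G i‖ := by
      have : (a : ℂ) * Y (i + 1) = Y (i + 2) + Y i - G i := by rw [hY]; ring
      calc |a| * ‖Y (i + 1)‖ = ‖(a : ℂ) * Y (i + 1)‖ := by simp
        _ ≤ ‖Y (i + 2) + Y i‖ + ‖G i‖ := by rw [this]; exact norm_sub_le _ _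
        _ ≤ _ := by gcongr; exact norm_add_le _ _
    have h2 : 4 * ‖Y (i + 1)‖ ≤ |a| * ‖Y (i + 1)‖ := by gcongr
    have : i + 1 + 1 = i + 2 := rfl
    rw [this]
    linarith [norm_nonneg (Y (i + 1))]

/-- The factor `W (j+1) - z̄ W j` of a second order recurrence with characteristic roots `z`, `z̄`
on the unit circle has constant modulus, up to the size of the data. -/
theorem wave_factor_norm {n : ℕ} {z : ℂ} {W G : ℕ → ℂ} (hz : ‖z‖ = 1)
    (hW : ∀ i < n, W (i + 2) = (z + (starRingEnd ℂ) z) * W (i + 1) - W i + G i) :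
    ∀ i ≤ n, |‖W (i + 1) - (starRingEnd ℂ) z * W i‖ - ‖W 1 - (starRingEnd ℂ) z * W 0‖| ≤
      ∑ j ∈ Finset.range i, ‖G j‖ := by
  have hzz : z * (starRingEnd ℂ) z = 1 := by rw [Complex.mul_conj']; simp [hz]
  intro i
  induction i with
  | zero => intro _; simp
  | succ i ih =>
    intro hi
    have ih := ih (by omega)
    have hW := hW i (by omega)
    -- The recurrence factors as (shift − z)(shift − z̄), so this factor is multiplied by z at each
    -- step.
    have h1 : W (i + 1 + 1) - (starRingEnd ℂ) z * W (i + 1) =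
        z * (W (i + 1) - (starRingEnd ℂ) z * W i) + G i := by
      rw [show i + 1 + 1 = i + 2 from rfl, hW]
      linear_combination W i * hzz
    have h2 : |‖W (i + 1 + 1) - (starRingEnd ℂ) z * W (i + 1)‖ -
        ‖W (i + 1) - (starRingEnd ℂ) z * W i‖| ≤ ‖G i‖ := by
      have := abs_norm_sub_norm_le (z * (W (i + 1) - (starRingEnd ℂ) z * W i) + G i)
        (z * (W (i + 1) - (starRingEnd ℂ) z * W i))
      rw [add_sub_cancel_left, norm_mul z, hz, one_mul] at this
      rwa [h1]
    rw [Finset.sum_range_succ]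
    calc _ ≤ _ := abs_sub_le _ (‖W (i + 1) - (starRingEnd ℂ) z * W i‖) _
      _ ≤ _ := by linarith

/-- The flux of a wave is the difference of the energies of its two travelling parts. -/
theorem normSq_sub_normSq_eq_flux (z a b : ℂ) :
    ‖a - (starRingEnd ℂ) z * b‖ ^ 2 - ‖a - z * b‖ ^ 2 =
      4 * z.im * (a * (starRingEnd ℂ) b).im := by
  rw [← Complex.normSq_eq_norm_sq, ← Complex.normSq_eq_norm_sq]
  simp [Complex.normSq_apply]
  ring

/-- A wave is controlled by its two travelling parts. -/
theorem norm_wave_increment_le {z a b : ℂ} {t M : ℝ} (ht : 0 < t) (hz : 3 / 4 * t ≤ z.im)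
    (hz1 : ‖z - 1‖ ≤ t) (hp : ‖a - (starRingEnd ℂ) z * b‖ ≤ M) (hq : ‖a - z * b‖ ≤ M) :
    ‖a - b‖ ≤ 4 / 3 * M := by
  have hM : 0 ≤ M := (norm_nonneg _).trans hp
  -- In the increment, unlike in `a` or `b` alone, the weights z − 1 are of order t and compensate
  -- the division by Im z.
  have key : (2 * z.im * Complex.I) * (a - b) =
      (z - 1) * (a - (starRingEnd ℂ) z * b) - (starRingEnd ℂ) (z - 1) * (a - z * b) := by
    have : (2 * z.im * Complex.I : ℂ) = z - (starRingEnd ℂ) z := by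
      rw [Complex.sub_conj]; push_cast; ring
    rw [this, map_sub, map_one]; ring
  have h1 : ‖(2 * z.im * Complex.I) * (a - b)‖ ≤ t * M + t * M := by
    rw [key]
    refine (norm_sub_le _ _).trans ?_
    rw [norm_mul, norm_mul, Complex.norm_conj]
    gcongr
  have h2 : ‖(2 * z.im * Complex.I) * (a - b)‖ = 2 * z.im * ‖a - b‖ := by
    have : 0 ≤ z.im := by linarith
    simp [abs_of_nonneg this]
  rw [h2] at h1
  have h3 : 3 / 2 * t * ‖a - b‖ ≤ 2 * z.im * ‖a - b‖ :=
    mul_le_mul_of_nonneg_right (by linarith) (norm_nonneg _)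
  have h4 : t * (3 / 2 * ‖a - b‖) ≤ t * (2 * M) := by linarith
  have := le_of_mul_le_mul_left h4 ht
  linarith

/-- Stability of the wave coupled to the evanescent part at the right end. -/
theorem coupled_bound {n : ℕ} {t a : ℝ} {z κ : ℂ} {Y W G : ℕ → ℂ}
    (ht : 0 < t) (ht1 : t ≤ 1) (ha : 4 ≤ |a|) (hz : ‖z‖ = 1) (hzi : 3 / 4 * t ≤ z.im)
    (hz1 : ‖z - 1‖ ≤ t) (hκ : ‖κ‖ ≤ 2 / 3 * t ^ 2) (hκi : κ.im ≤ t / 5)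
    (hn : 1 ≤ n) (hY0 : Y 0 = 0) (hW0 : W 0 = 0)
    (hY : ∀ i < n, Y (i + 2) = a * Y (i + 1) - Y i + G i)
    (hW : ∀ i < n, W (i + 2) = (z + (starRingEnd ℂ) z) * W (i + 1) - W i + G i)
    (hYn : Y (n + 1) = (1 + Complex.I * t + κ) * Y n - κ * W n)
    (hWn : W (n + 1) = (1 + Complex.I * t - κ) * W n + κ * Y n) :
    ∀ i < n, ‖Y (i + 1) - Y i‖ ≤ 30 * ∑ j ∈ Finset.range n, ‖G j‖ ∧
      ‖W (i + 1) - W i‖ ≤ 111 * ∑ j ∈ Finset.range n, ‖G j‖ := by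
  set S := ∑ j ∈ Finset.range n, ‖G j‖ with hS
  have hS0 : 0 ≤ S := Finset.sum_nonneg fun _ _ => norm_nonneg _
  have hGS : ∀ i < n, ‖G i‖ ≤ S := fun i hi =>
    Finset.single_le_sum (f := fun j => ‖G j‖) (fun _ _ => norm_nonneg _) (Finset.mem_range.2 hi)
  have hgrow := evanescent_growth ha hS0 hGS hY0 hY
  have hpart : ∀ i ≤ n, ∑ j ∈ Finset.range i, ‖G j‖ ≤ S := fun i hi =>
    Finset.sum_le_sum_of_subset_of_nonneg (Finset.range_mono hi) fun _ _ _ => norm_nonneg _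
  have hp := fun i hi => (wave_factor_norm hz hW i hi).trans (hpart i hi)
  -- The recurrence is symmetric in z and z̄; as W 0 = 0, both factors start from the same modulus
  -- ‖W 1‖.
  have hq := fun i hi => (wave_factor_norm (z := (starRingEnd ℂ) z) (W := W) (G := G) (by simpa using hz)
    (fun i hi => by rw [Complex.conj_conj, hW i hi]; ring) i hi).trans (hpart i hi)
  simp only [Complex.conj_conj, hW0, mul_zero, sub_zero] at hp hq
  set w := ‖W n‖ with hw
  set y := ‖Y n‖ with hy
  have hw0 : 0 ≤ w := norm_nonneg _
  have hy0 : 0 ≤ y := norm_nonneg _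
  have htt : t ^ 2 ≤ t := by nlinarith
  have hIt : ‖Complex.I * (t : ℂ)‖ = t := by simp [abs_of_pos ht]
  -- the evanescent part at the right end
  have hyw : y ≤ ‖κ‖ * w + 3 / 2 * S := by
    have h1 : ‖Y (n + 1)‖ ≤ (1 + t + ‖κ‖) * y + ‖κ‖ * w := by
      rw [hYn]
      refine (norm_sub_le _ _).trans ?_
      rw [norm_mul, norm_mul]
      gcongr
      refine (norm_add_le _ _).trans ?_
      gcongr
      refine (norm_add_le _ _).trans ?_
      rw [hIt, norm_one]
    -- Up to data, the recurrence forces growth by 4 − 1/3 in the last step, while the end condition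
    -- allows only 1 + t + ‖κ‖ ≤ 8/3; the gap is exactly 1.
    obtain ⟨m, rfl⟩ : ∃ m, n = m + 1 := ⟨n - 1, by omega⟩
    have h2 := hgrow (m + 1) le_rfl
    have h3 := hgrow m (by omega)
    have h4 := hY m (by omega)
    have h5 := hGS m (by omega)
    have h6 : |a| * ‖Y (m + 1)‖ ≤ ‖Y (m + 2)‖ + ‖Y m‖ + ‖G m‖ := by
      have : (a : ℂ) * Y (m + 1) = Y (m + 2) + Y m - G m := by rw [h4]; ring
      calc |a| * ‖Y (m + 1)‖ = ‖(a : ℂ) * Y (m + 1)‖ := by simp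
        _ ≤ ‖Y (m + 2) + Y m‖ + ‖G m‖ := by rw [this]; exact norm_sub_le _ _
        _ ≤ _ := by gcongr; exact norm_add_le _ _
    have h7 : 4 * ‖Y (m + 1)‖ ≤ |a| * ‖Y (m + 1)‖ := by gcongr
    have h8 : (1 + t + ‖κ‖) * y ≤ 8 / 3 * y := by gcongr; nlinarith
    have h9 : ‖Y (m + 2)‖ = ‖Y (m + 1 + 1)‖ := rfl
    linarith
  have hκy : ‖κ‖ * y ≤ 4 / 9 * (t * w) + t * S := by
    have h1 : ‖κ‖ * y ≤ (2 / 3 * t) * ((2 / 3) * w + 3 / 2 * S) := by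
      have : ‖κ‖ ≤ 2 / 3 * t := by linarith
      have h2 : y ≤ 2 / 3 * w + 3 / 2 * S := by
        have : ‖κ‖ * w ≤ 2 / 3 * w := by gcongr; linarith
        linarith
      gcongr
    linarith
  have htS : t * S ≤ S := by nlinarith
  -- Applied with ζ = z and ζ = z̄: at the right end both travelling parts have size O(tw), not
  -- merely O(w).
  have hfac : ∀ ζ : ℂ, ‖ζ - 1‖ ≤ t → ‖W (n + 1) - ζ * W n‖ ≤ 4 * (t * w) + S := by
    intro ζ hζ
    have e : W (n + 1) - ζ * W n = (Complex.I * t - κ - (ζ - 1)) * W n + κ * Y n := by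
      rw [hWn]; ring
    rw [e]
    have h1 : ‖Complex.I * t - κ - (ζ - 1)‖ ≤ t + 2 / 3 * t + t := by
      refine (norm_sub_le _ _).trans (add_le_add ((norm_sub_le _ _).trans ?_) hζ)
      rw [hIt]; linarith
    calc _ ≤ ‖Complex.I * t - κ - (ζ - 1)‖ * ‖W n‖ + ‖κ‖ * ‖Y n‖ := by
            refine (norm_add_le _ _).trans ?_
            rw [norm_mul, norm_mul]
      _ ≤ (t + 2 / 3 * t + t) * w + (4 / 9 * (t * w) + t * S) := by gcongr
      _ ≤ _ := by nlinarith [mul_nonneg ht.le hw0]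
  have hzc1 : ‖(starRingEnd ℂ) z - 1‖ ≤ t := by
    have : (starRingEnd ℂ) z - 1 = (starRingEnd ℂ) (z - 1) := by simp
    rw [this, Complex.norm_conj]; exact hz1
  have hP := hfac _ hzc1
  have hR := hfac _ hz1
  -- the flux at the right end
  have hflux : 4 / 5 * (t * w) * w - (4 / 9 * (t * w) + t * S) * w ≤
      (W (n + 1) * (starRingEnd ℂ) (W n)).im := by
    have e : (W (n + 1) * (starRingEnd ℂ) (W n)).im =
        (t - κ.im) * w ^ 2 + (κ * Y n * (starRingEnd ℂ) (W n)).im := by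
      have : W (n + 1) * (starRingEnd ℂ) (W n) =
          (1 + Complex.I * t - κ) * ((w ^ 2 : ℝ) : ℂ) + κ * Y n * (starRingEnd ℂ) (W n) := by
        rw [hWn]; push_cast; rw [hw, ← Complex.mul_conj']; ring
      rw [this, Complex.add_im, Complex.im_mul_ofReal]
      simp
    have h1 : |(κ * Y n * (starRingEnd ℂ) (W n)).im| ≤ ‖κ‖ * y * w := by
      refine (Complex.abs_im_le_norm _).trans ?_
      rw [norm_mul, norm_mul, Complex.norm_conj]
    have h2 : ‖κ‖ * y * w ≤ (4 / 9 * (t * w) + t * S) * w := by gcongr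
    have h3 : (4 / 5 * t) * w ^ 2 ≤ (t - κ.im) * w ^ 2 := by gcongr; linarith
    rw [e]
    nlinarith [neg_abs_le (κ * Y n * (starRingEnd ℂ) (W n)).im]
  -- The flux bounds P² − R² below by about (16/15)(tw)², with 16/45 = 4/5 − 4/9, whereas (P − R)(P
  -- + R) is at most 2S(8tw + 2S). This is impossible once tw exceeds 20S.
  have hω : t * w ≤ 20 * S := by
    by_contra! hcon
    have hPR := normSq_sub_normSq_eq_flux z (W (n + 1)) (W n)
    set P := ‖W (n + 1) - (starRingEnd ℂ) z * W n‖
    set R := ‖W (n + 1) - z * W n‖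
    have hPR1 : P - R ≤ 2 * S := by
      have h1 := abs_le.1 (hp n le_rfl)
      have h2 := abs_le.1 (hq n le_rfl)
      linarith [h1.2, h2.1]
    have hPR2 : P ^ 2 - R ^ 2 ≤ 2 * S * (8 * (t * w) + 2 * S) := by
      calc P ^ 2 - R ^ 2 = (P - R) * (P + R) := by ring
        _ ≤ 2 * S * (P + R) :=
          mul_le_mul_of_nonneg_right hPR1 (add_nonneg (norm_nonneg _) (norm_nonneg _))
        _ ≤ _ := mul_le_mul_of_nonneg_left (by linarith) (by linarith)
    have hL : 0 ≤ 16 / 45 * (t * w) - t * S := by linarith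
    have h1 : 3 * t * (w * (16 / 45 * (t * w) - t * S)) ≤ P ^ 2 - R ^ 2 := by
      rw [hPR]
      have : w * (16 / 45 * (t * w) - t * S) ≤ (W (n + 1) * (starRingEnd ℂ) (W n)).im := by
        linarith
      have h0 : 0 ≤ w * (16 / 45 * (t * w) - t * S) := by positivity
      calc _ ≤ 4 * z.im * (w * (16 / 45 * (t * w) - t * S)) :=
            mul_le_mul_of_nonneg_right (by linarith) h0
        _ ≤ _ := mul_le_mul_of_nonneg_left this (by linarith)
    have h2 : 3 * (t * w) * (16 / 45 * (t * w) - S) ≤ 2 * S * (8 * (t * w) + 2 * S) := by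
      have : 3 * (t * w) * (16 / 45 * (t * w) - S) ≤
        3 * (t * w) * (16 / 45 * (t * w) - t * S) := by gcongr
      linarith
    nlinarith
  have hyS : y ≤ 15 * S := by
    have : ‖κ‖ * w ≤ 2 / 3 * (t * w) := by
      calc ‖κ‖ * w ≤ (2 / 3 * t) * w := by gcongr; linarith
        _ = _ := by ring
    linarith
  -- Growth towards the right end, read backwards, is decay away from it.
  have hYall : ∀ m ≤ n, ‖Y (n - m)‖ ≤ 15 * S := by
    intro m
    induction m with
    | zero => intro _; exact hyS
    | succ m ih =>
      intro hm
      have h1 := hgrow (n - (m + 1)) (by omega)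
      rw [show n - (m + 1) + 1 = n - m by omega] at h1
      linarith [ih (by omega)]
  have hY' : ∀ j ≤ n, ‖Y j‖ ≤ 15 * S := fun j hj => by
    have := hYall (n - j) (by omega)
    rwa [show n - (n - j) = j by omega] at this
  intro i hi
  constructor
  · exact (norm_sub_le _ _).trans (by linarith [hY' i hi.le, hY' (i + 1) hi])
  · have hpi : ‖W (i + 1) - (starRingEnd ℂ) z * W i‖ ≤ 83 * S := by
      have h1 := abs_le.1 (hp n le_rfl)
      have h2 := abs_le.1 (hp i hi.le)
      linarith [h1.1, h2.2]
    have hqi : ‖W (i + 1) - z * W i‖ ≤ 83 * S := by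
      have h1 := abs_le.1 (hq n le_rfl)
      have h2 := abs_le.1 (hq i hi.le)
      linarith [h1.1, h2.2]
    have := norm_wave_increment_le ht hzi hz1 hpi hqi
    linarith

set_option maxHeartbeats 2000000 in
/-- Stability of the five-point difference scheme with the impedance condition at the right end,
in which `U (n+1)` and `Q (n+1)` are ghost values. -/
theorem scheme_bound {n : ℕ} {t γ : ℝ} {U Q G : ℕ → ℂ} (hn : 1 ≤ n) (ht : 0 < t) (ht1 : t ≤ 1)
    (hγ0 : γ ≠ 0) (hγ : |γ| ≤ 1 / 6) (hU0 : U 0 = 0) (hQ0 : Q 0 = 0)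
    (hQ : ∀ i < n, Q (i + 1) = 2 * U (i + 1) - U i - U (i + 2))
    (hrow : ∀ i < n, Q (i + 1) - t ^ 2 / 6 * (U i + 4 * U (i + 1) + U (i + 2)) +
      γ * (2 * Q (i + 1) - Q i - Q (i + 2)) = G i)
    (hUn : U (n + 1) = (1 + Complex.I * t) * U n)
    (hQn : γ * (Q (n + 1) - (1 + Complex.I * t) * Q n) = -(t ^ 2 / 6) * (2 * U n + U (n + 1))) :
    ∀ i < n, ‖U (i + 1) - U i‖ ≤ 200 * ∑ j ∈ Finset.range n, ‖G j‖ := by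
  obtain ⟨hγl, hγu⟩ := abs_le.1 hγ
  have htt : t ^ 2 ≤ 1 := by nlinarith
  have ht2 : 0 < t ^ 2 := by positivity
  obtain ⟨A, hA⟩ : ∃ A : ℝ, A = 1 + t ^ 2 / 6 := ⟨_, rfl⟩
  -- Equality holds at γ = −1/6; this is where the bound on negative γ enters, and it yields B ≥ 1.
  have hD : (1 - t ^ 2 / 6) ^ 2 ≤ A ^ 2 + 4 * γ * t ^ 2 := by rw [hA]; nlinarith
  obtain ⟨d, hd⟩ : ∃ d : ℝ, d = √(A ^ 2 + 4 * γ * t ^ 2) := ⟨_, rfl⟩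
  have hd2 : d ^ 2 = A ^ 2 + 4 * γ * t ^ 2 := by
    rw [hd, Real.sq_sqrt ((sq_nonneg _).trans hD)]
  have hdl : 1 - t ^ 2 / 6 ≤ d := by rw [hd]; exact Real.le_sqrt_of_sq_le hD
  have hdu : d ≤ 3 / 2 := by
    have : d ^ 2 ≤ (3 / 2) ^ 2 := by rw [hd2, hA]; nlinarith
    exact le_of_sq_le_sq this (by norm_num)
  have hd56 : 5 / 6 ≤ d := by linarith
  have hd0 : 0 < d := by linarith
  -- The roots of γX² + AX − t² are −B/γ and −B'/γ = ξ.
  obtain ⟨B, hB⟩ : ∃ B : ℝ, B = (A + d) / 2 := ⟨_, rfl⟩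
  obtain ⟨B', hB'⟩ : ∃ B' : ℝ, B' = (A - d) / 2 := ⟨_, rfl⟩
  have hB1 : 1 ≤ B := by rw [hB, hA]; linarith
  have hBu : B ≤ 4 / 3 := by rw [hB, hA]; linarith
  have hBB : B * B' = -γ * t ^ 2 := by rw [hB, hB']; linarith
  have hBA : B + B' = A := by rw [hB, hB']; ring
  have hBd : B - B' = d := by rw [hB, hB']; ring
  obtain ⟨ξ, hξ⟩ : ∃ ξ : ℝ, ξ = t ^ 2 / B := ⟨_, rfl⟩
  have hB0 : 0 < B := by linarith
  have hξB : ξ * B = t ^ 2 := by rw [hξ]; field_simp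
  have hξu : ξ ≤ t ^ 2 := by rw [hξ]; exact div_le_self ht2.le hB1
  have hξl : 3 / 4 * t ^ 2 ≤ ξ := by
    rw [hξ, le_div_iff₀ hB0]; nlinarith
  have hξ0 : 0 < ξ := by linarith
  have hBξ : B' = -γ * ξ := by
    have : B * B' = B * (-γ * ξ) := by rw [hBB, ← hξB]; ring
    exact mul_left_cancel₀ hB0.ne' this
  -- the unimodular root
  obtain ⟨z, hz⟩ : ∃ z : ℂ, z = ⟨1 - ξ / 2, √(ξ - ξ ^ 2 / 4)⟩ := ⟨_, rfl⟩
  have hs : 0 ≤ ξ - ξ ^ 2 / 4 := by nlinarith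
  have hs2 : √(ξ - ξ ^ 2 / 4) ^ 2 = ξ - ξ ^ 2 / 4 := Real.sq_sqrt hs
  have hznorm : ‖z‖ = 1 := by
    rw [← sq_eq_sq₀ (norm_nonneg _) zero_le_one, ← Complex.normSq_eq_norm_sq, Complex.normSq_apply,
      hz]
    linarith
  have hzi : 3 / 4 * t ≤ z.im := by
    rw [hz]
    refine Real.le_sqrt_of_sq_le ?_
    nlinarith
  have hz1 : ‖z - 1‖ ≤ t := by
    refine le_of_sq_le_sq ?_ ht.le
    rw [← Complex.normSq_eq_norm_sq, Complex.normSq_apply, hz]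
    simp only [Complex.sub_re, Complex.sub_im, Complex.one_re, Complex.one_im]
    linarith
  have hzz : z + (starRingEnd ℂ) z = ((2 - ξ : ℝ) : ℂ) := by
    rw [Complex.add_conj, hz]; congr 1; ring
  -- the coupling coefficient
  obtain ⟨κ, hκ⟩ : ∃ κ : ℂ, κ = ((t ^ 2 / (6 * d) : ℝ) : ℂ) * (3 + Complex.I * t) := ⟨_, rfl⟩
  have hc0 : 0 ≤ t ^ 2 / (6 * d) := by positivity
  have hc : t ^ 2 / (6 * d) ≤ t ^ 2 / 5 := by gcongr; linarith
  have hκn : ‖κ‖ ≤ 2 / 3 * t ^ 2 := by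
    have h3 : ‖(3 + Complex.I * t : ℂ)‖ ≤ 10 / 3 := by
      refine le_of_sq_le_sq ?_ (by norm_num)
      rw [← Complex.normSq_eq_norm_sq, Complex.normSq_apply]
      simp
      nlinarith
    rw [hκ, norm_mul, Complex.norm_real, Real.norm_of_nonneg hc0]
    calc _ ≤ t ^ 2 / 5 * (10 / 3) := by gcongr
      _ = _ := by ring
  have hκi : κ.im ≤ t / 5 := by
    rw [hκ, Complex.im_ofReal_mul]
    simp
    nlinarith
  have hγc : (γ : ℂ) ≠ 0 := by exact_mod_cast hγ0
  have hdc : (d : ℂ) ≠ 0 := by exact_mod_cast hd0.ne'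
  have cBd : (B : ℂ) - B' = d := by exact_mod_cast hBd
  have cBA : (B : ℂ) + B' = 1 + t ^ 2 / 6 := by rw [hA] at hBA; exact_mod_cast hBA
  have cBξ : (B' : ℂ) = -γ * ξ := by exact_mod_cast hBξ
  have cξB : (ξ : ℂ) * B = t ^ 2 := by exact_mod_cast hξB
  have hκd : κ * d = t ^ 2 / 6 * (3 + Complex.I * t) := by
    rw [hκ]; push_cast; field_simp
  -- Each of Y and W is −γ times one linear factor applied to U, so only the other factor remains in
  -- its recurrence. Since Y − W = dU, the term in U n in the end condition becomes κ(Y n − W n).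
  have key := coupled_bound (n := n) (t := t) (a := 2 + B / γ) (z := z) (κ := κ)
    (Y := fun j => -γ * Q j - B' * U j) (W := fun j => -γ * Q j - B * U j) (G := G)
    ht ht1 ?_ hznorm hzi hz1 hκn hκi hn ?_ ?_ ?_ ?_ ?_ ?_
  · intro i hi
    obtain ⟨h1, h2⟩ := key i hi
    have hS0 : 0 ≤ ∑ j ∈ Finset.range n, ‖G j‖ := Finset.sum_nonneg fun _ _ => norm_nonneg _
    set S := ∑ j ∈ Finset.range n, ‖G j‖
    have e : (d : ℂ) * (U (i + 1) - U i) =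
        (-γ * Q (i + 1) - B' * U (i + 1) - (-γ * Q i - B' * U i)) -
        (-γ * Q (i + 1) - B * U (i + 1) - (-γ * Q i - B * U i)) := by
      rw [← cBd]; ring
    have h3 : d * ‖U (i + 1) - U i‖ ≤ 30 * S + 111 * S := by
      calc d * ‖U (i + 1) - U i‖ = ‖(d : ℂ) * (U (i + 1) - U i)‖ := by
            rw [norm_mul, Complex.norm_real, Real.norm_of_nonneg hd0.le]
        _ ≤ _ := by rw [e]; exact (norm_sub_le _ _).trans (add_le_add h1 h2)
    have h4 : 5 / 6 * ‖U (i + 1) - U i‖ ≤ d * ‖U (i + 1) - U i‖ := by gcongr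
    linarith
  -- For negative γ the 2 is subtracted in modulus, leaving 6 − 2 = 4.
  · have h6 : 6 ≤ |B / γ| := by
      rw [abs_div, abs_of_pos hB0, le_div_iff₀ (abs_pos.2 hγ0)]
      linarith
    have := abs_sub_abs_le_abs_sub (B / γ) (-2)
    rw [abs_neg, abs_two, sub_neg_eq_add, add_comm (B / γ)] at this
    linarith
  · simp [hU0, hQ0]
  · simp [hU0, hQ0]
  · intro i hi
    have h1 := hQ i hi
    have h2 := hrow i hi
    have h3 : ((2 + B / γ : ℝ) : ℂ) * (-γ * Q (i + 1) - B' * U (i + 1)) =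
        2 * (-γ * Q (i + 1) - B' * U (i + 1)) - B * Q (i + 1) + t ^ 2 * U (i + 1) := by
      rw [← cξB, cBξ]; push_cast; field_simp; ring
    rw [h3]
    linear_combination (t ^ 2 / 6 - B') * h1 + h2 + Q (i + 1) * cBA
  · intro i hi
    have h1 := hQ i hi
    have h2 := hrow i hi
    have h3 : (z + (starRingEnd ℂ) z) * (-γ * Q (i + 1) - B * U (i + 1)) =
        2 * (-γ * Q (i + 1) - B * U (i + 1)) - B' * Q (i + 1) + t ^ 2 * U (i + 1) := by
      rw [← cξB, cBξ, hzz]; push_cast; ring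
    rw [h3]
    linear_combination (t ^ 2 / 6 - B) * h1 + h2 + Q (i + 1) * cBA
  · rw [hUn] at hQn
    simp only [hUn]
    linear_combination (-1) * hQn + U n * (-κ * cBd - hκd)
  · rw [hUn] at hQn
    simp only [hUn]
    linear_combination (-1) * hQn + U n * (-κ * cBd - hκd)

/-! ### The mesh, nodal values and hat functions. -/

open MeasureTheory Set Filter Topology

theorem node_zero (n : ℕ) : node n 0 = 0 := by simp [node]

theorem node_self {n : ℕ} (hn : 1 ≤ n) : node n n = 1 := by
  have : (n : ℝ) ≠ 0 := by exact_mod_cast (by omega : n ≠ 0)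
  simp [node, this]

theorem mul_node {n : ℕ} (hn : 1 ≤ n) (j : ℕ) : (n : ℝ) * node n j = j := by
  have : (n : ℝ) ≠ 0 := by exact_mod_cast (by omega : n ≠ 0)
  rw [node]; field_simp

theorem node_mono (n : ℕ) : Monotone (node n) := fun i j h => by
  unfold node; gcongr

theorem node_lt_succ {n : ℕ} (hn : 1 ≤ n) (j : ℕ) : node n j < node n (j + 1) := by
  have : (0 : ℝ) < n := by exact_mod_cast hn
  unfold node; gcongr; simp

theorem node_mem_Icc {n : ℕ} (hn : 1 ≤ n) {j : ℕ} (hj : j ≤ n) : node n j ∈ Icc (0 : ℝ) 1 :=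
  ⟨node_zero n ▸ node_mono n (Nat.zero_le j), node_self hn ▸ node_mono n hj⟩

theorem cell_subset {n : ℕ} (hn : 1 ≤ n) {i : ℕ} (hi : i < n) :
    Icc (node n i) (node n (i + 1)) ⊆ Icc (0 : ℝ) 1 :=
  Icc_subset_Icc (node_mem_Icc hn hi.le).1 (node_mem_Icc hn hi).2

/-- Every point of `[0,1]` lies in a closed cell. -/
theorem exists_mem_cell {n : ℕ} (hn : 1 ≤ n) {x : ℝ} (hx : x ∈ Icc (0 : ℝ) 1) :
    ∃ i < n, x ∈ Icc (node n i) (node n (i + 1)) := by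
  have hn0 : (0 : ℝ) < n := by exact_mod_cast hn
  rcases hx.2.eq_or_lt with h | h
  · refine ⟨n - 1, by omega, ?_, ?_⟩
    · rw [h]; exact (node_mem_Icc hn (by omega)).2
    · rw [show n - 1 + 1 = n by omega, node_self hn]; exact hx.2
  · have h0 : 0 ≤ n * x := mul_nonneg hn0.le hx.1
    refine ⟨⌊n * x⌋₊, ?_, ?_, ?_⟩
    · rw [Nat.floor_lt h0]; nlinarith
    · rw [node, div_le_iff₀ hn0, mul_comm x]; exact Nat.floor_le h0
    · rw [node, le_div_iff₀ hn0, mul_comm x]; push_cast; exact (Nat.lt_floor_add_one _).le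

/-- The affine function on the cell number `i` with the values `V i`, `V (i+1)` at its ends. -/
noncomputable def cellAffine (n : ℕ) (V : ℕ → ℂ) (i : ℕ) (x : ℝ) : ℂ :=
  V i + (V (i + 1) - V i) * ((n * x - i : ℝ) : ℂ)

theorem continuous_cellAffine (n : ℕ) (V : ℕ → ℂ) (i : ℕ) : Continuous (cellAffine n V i) := by
  unfold cellAffine; fun_prop

theorem hasDerivAt_cellAffine (n : ℕ) (V : ℕ → ℂ) (i : ℕ) (x : ℝ) :
    HasDerivAt (cellAffine n V i) (n * (V (i + 1) - V i)) x := by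
  have h : HasDerivAt (fun x : ℝ => (n * x - i : ℝ)) (n : ℝ) x := by
    simpa using ((hasDerivAt_id x).const_mul (n : ℝ)).sub_const (i : ℝ)
  have := (h.ofReal_comp.const_mul (V (i + 1) - V i)).const_add (V i)
  exact this.congr_deriv (by push_cast; ring)

/-- `v` is the piecewise affine function with the nodal values `V`. -/
def HasNodal (n : ℕ) (v : ℝ → ℂ) (V : ℕ → ℂ) : Prop :=
  ∀ i < n, ∀ x ∈ Icc (node n i) (node n (i + 1)), v x = cellAffine n V i x

/-- A finite element function is determined by its nodal values. -/
theorem hasNodal_of_mem {n : ℕ} (hn : 1 ≤ n) {v : ℝ → ℂ} (hv : v ∈ femSpace n) :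
    HasNodal n v fun j => v (node n j) := by
  obtain ⟨-, hc, -, hp⟩ := hv
  intro i hi
  obtain ⟨a, b, hab⟩ := hp i hi
  have hlt := node_lt_succ hn i
  have heq : EqOn v (fun x : ℝ => a + b * (x : ℂ)) (Icc (node n i) (node n (i + 1))) := by
    refine EqOn.of_subset_closure hab (hc.mono (cell_subset hn hi)) (by fun_prop)
      Ioo_subset_Icc_self ?_
    rw [closure_Ioo hlt.ne]
  intro x hx
  have h1 := heq (left_mem_Icc.2 hlt.le)
  have h2 := heq (right_mem_Icc.2 hlt.le)
  have e1 := mul_node hn i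
  have e2 := mul_node hn (i + 1)
  have hn0 : (n : ℝ) ≠ 0 := by exact_mod_cast (by omega : n ≠ 0)
  have e3 : (n : ℂ) * ((node n (i + 1) : ℝ) - (node n i : ℝ)) = 1 := by
    have : (n : ℝ) * (node n (i + 1) - node n i) = 1 := by rw [mul_sub, e1, e2]; push_cast; ring
    exact_mod_cast this
  have e4 : (n : ℂ) * (node n i : ℝ) = i := by exact_mod_cast e1
  simp only at h1 h2
  rw [heq hx]
  simp only [cellAffine]
  rw [h1, h2]
  push_cast
  linear_combination b * (node n i - x) * e3 - b * (node n (i + 1) - node n i) * e4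

/-- The hat function of the node `j`. -/
noncomputable def hat (n j : ℕ) (x : ℝ) : ℝ := max 0 (1 - |n * x - j|)

theorem continuous_hat (n j : ℕ) : Continuous (hat n j) := by unfold hat; fun_prop

theorem hat_nonneg (n j : ℕ) (x : ℝ) : 0 ≤ hat n j x := le_max_left _ _

/-- On a cell, only the hat functions of its two ends contribute. -/
theorem sum_hat {n : ℕ} (hn : 1 ≤ n) (V : ℕ → ℂ) {i : ℕ} (hi : i < n) {x : ℝ}
    (hx : x ∈ Icc (node n i) (node n (i + 1))) :
    ∑ j ∈ Finset.range (n + 1), V j * hat n j x = cellAffine n V i x := by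
  have hn0 : (0 : ℝ) ≤ n := Nat.cast_nonneg n
  have h1 : (i : ℝ) ≤ n * x := by
    rw [← mul_node hn i]; exact mul_le_mul_of_nonneg_left hx.1 hn0
  have h2 : n * x ≤ (i : ℝ) + 1 := by
    have := mul_node hn (i + 1)
    push_cast at this
    rw [← this]; exact mul_le_mul_of_nonneg_left hx.2 hn0
  have hsub : ({i, i + 1} : Finset ℕ) ⊆ Finset.range (n + 1) := by
    intro j; simp; omega
  rw [← Finset.sum_subset hsub, Finset.sum_pair (by omega)]
  · have e1 : hat n i x = 1 - (n * x - i) := by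
      rw [hat, abs_of_nonneg (by linarith), max_eq_right (by linarith)]
    have e2 : hat n (i + 1) x = n * x - i := by
      rw [hat, abs_of_nonpos (by push_cast; linarith), max_eq_right (by push_cast; linarith)]
      push_cast; ring
    rw [e1, e2, cellAffine]; push_cast; ring
  · intro j _ hj
    have hj : j + 1 ≤ i ∨ i + 2 ≤ j := by simp at hj; omega
    have : hat n j x = 0 := by
      rw [hat, max_eq_left]
      rcases hj with hj | hj
      · have : (j : ℝ) + 1 ≤ i := by exact_mod_cast hj
        linarith [le_abs_self (n * x - j)]
      · have : (i : ℝ) + 2 ≤ j := by exact_mod_cast hj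
        linarith [neg_le_abs (n * x - j)]
    simp [this]

/-- The piecewise affine interpolant of nodal values. -/
noncomputable def interp (n : ℕ) (V : ℕ → ℂ) (x : ℝ) : ℂ :=
  ∑ j ∈ Finset.range (n + 1), V j * hat n j x

theorem continuous_interp (n : ℕ) (V : ℕ → ℂ) : Continuous (interp n V) := by
  have := continuous_hat n
  unfold interp; fun_prop

theorem hasNodal_interp {n : ℕ} (hn : 1 ≤ n) (V : ℕ → ℂ) : HasNodal n (interp n V) V :=
  fun _ hi _ hx => sum_hat hn V hi hx

theorem HasNodal.eqOn {n : ℕ} (hn : 1 ≤ n) {v w : ℝ → ℂ} {V : ℕ → ℂ} (hv : HasNodal n v V)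
    (hw : HasNodal n w V) : EqOn v w (Icc 0 1) := fun x hx => by
  obtain ⟨i, hi, hxi⟩ := exists_mem_cell hn hx
  rw [hv i hi x hxi, hw i hi x hxi]

theorem HasNodal.apply_node {n : ℕ} (hn : 1 ≤ n) {v : ℝ → ℂ} {V : ℕ → ℂ} (hv : HasNodal n v V)
    {j : ℕ} (hj : j ≤ n) : v (node n j) = V j := by
  have e : ((n * node n j : ℝ) : ℂ) = j := by rw [mul_node hn]; simp
  rcases hj.eq_or_lt with rfl | h
  · have hlt := (node_lt_succ hn (j - 1)).le
    have ej : j - 1 + 1 = j := by omega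
    rw [hv (j - 1) (by omega) _ (by rw [← ej]; exact ⟨by simpa [ej] using hlt, le_rfl⟩),
      cellAffine, ej, Complex.ofReal_sub, e]
    rw [Complex.ofReal_natCast, Nat.cast_sub hn]; push_cast; ring
  · rw [hv j h _ (left_mem_Icc.2 (node_lt_succ hn j).le), cellAffine, Complex.ofReal_sub, e]
    simp

theorem HasNodal.apply_one {n : ℕ} (hn : 1 ≤ n) {v : ℝ → ℂ} {V : ℕ → ℂ} (hv : HasNodal n v V) :
    v 1 = V n := by rw [← node_self hn, hv.apply_node hn le_rfl]

/-- The derivative of a piecewise affine function inside a cell. -/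
theorem HasNodal.hasDerivAt {n : ℕ} {v : ℝ → ℂ} {V : ℕ → ℂ} (hv : HasNodal n v V)
    {i : ℕ} (hi : i < n) {x : ℝ} (hx : x ∈ Ioo (node n i) (node n (i + 1))) :
    HasDerivAt v (n * (V (i + 1) - V i)) x := by
  refine (hasDerivAt_cellAffine n V i x).congr_of_eventuallyEq ?_
  filter_upwards [Ioo_mem_nhds hx.1 hx.2] with y hy
  exact hv i hi y (Ioo_subset_Icc_self hy)

theorem HasNodal.leftLim_deriv {n : ℕ} (hn : 1 ≤ n) {v : ℝ → ℂ} {V : ℕ → ℂ}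
    (hv : HasNodal n v V) {i : ℕ} (hi : i < n) :
    Function.leftLim (deriv v) (node n (i + 1)) = n * (V (i + 1) - V i) := by
  refine leftLim_eq_of_tendsto (tendsto_const_nhds.congr' ?_)
  filter_upwards [Ioo_mem_nhdsLT (node_lt_succ hn i)] with x hx
  exact (hv.hasDerivAt hi hx).deriv.symm

theorem HasNodal.rightLim_deriv {n : ℕ} (hn : 1 ≤ n) {v : ℝ → ℂ} {V : ℕ → ℂ}
    (hv : HasNodal n v V) {i : ℕ} (hi : i < n) :
    Function.rightLim (deriv v) (node n i) = n * (V (i + 1) - V i) := by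
  refine rightLim_eq_of_tendsto (tendsto_const_nhds.congr' ?_)
  filter_upwards [Ioo_mem_nhdsGT (node_lt_succ hn i)] with x hx
  exact (hv.hasDerivAt hi hx).deriv.symm

theorem HasNodal.jump_deriv {n : ℕ} (hn : 1 ≤ n) {v : ℝ → ℂ} {V : ℕ → ℂ}
    (hv : HasNodal n v V) {i : ℕ} (hi : i + 1 < n) :
    jump n (deriv v) (i + 1) = n * (2 * V (i + 1) - V i - V (i + 2)) := by
  rw [jump, hv.leftLim_deriv hn (by omega), hv.rightLim_deriv hn hi]
  ring

theorem HasNodal.derivAtOne_eq {n : ℕ} (hn : 1 ≤ n) {v : ℝ → ℂ} {V : ℕ → ℂ}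
    (hv : HasNodal n v V) : derivAtOne v = n * (V n - V (n - 1)) := by
  have := hv.leftLim_deriv hn (i := n - 1) (by omega)
  rwa [show n - 1 + 1 = n by omega, node_self hn] at this

/-! ### Cellwise integration, mass and stiffness. -/

theorem integral_vol {E : Type*} [NormedAddCommGroup E] [NormedSpace ℝ E] (g : ℝ → E) :
    ∫ x, g x ∂vol = ∫ x in (0 : ℝ)..1, g x := by
  rw [intervalIntegral.integral_of_le zero_le_one, integral_Ioc_eq_integral_Ioo]

/-- Integration cell by cell. -/
theorem integral_vol_eq_sum {n : ℕ} (hn : 1 ≤ n) {g : ℝ → ℂ} {G : ℕ → ℝ → ℂ}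
    (hG : ∀ i, Continuous (G i)) (hg : ∀ i < n, EqOn g (G i) (Ioo (node n i) (node n (i + 1)))) :
    ∫ x, g x ∂vol = ∑ i ∈ Finset.range n, ∫ x in node n i..node n (i + 1), G i x := by
  have hint : ∀ i < n, IntervalIntegrable g volume (node n i) (node n (i + 1)) := by
    intro i hi
    refine ((hG i).intervalIntegrable _ _).congr_uIoo ?_
    rw [uIoo_of_le (node_lt_succ hn i).le]
    exact (hg i hi).symm
  rw [integral_vol, ← node_self hn]
  conv_lhs => rw [← node_zero n]
  rw [← intervalIntegral.sum_integral_adjacent_intervals hint]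
  refine Finset.sum_congr rfl fun i hi => ?_
  exact intervalIntegral.integral_congr_Ioo_of_le (node_lt_succ hn i).le
    (hg i (Finset.mem_range.1 hi))

theorem integral_cell_quadratic {n : ℕ} (hn : 1 ≤ n) (i : ℕ) (α β δ : ℂ) :
    ∫ x in node n i..node n (i + 1), (α + β * ((n * x - i : ℝ) : ℂ) +
      δ * ((n * x - i : ℝ) : ℂ) ^ 2) = (n : ℂ)⁻¹ * (α + β / 2 + δ / 3) := by
  have hn0 : (n : ℝ) ≠ 0 := by exact_mod_cast (by omega : n ≠ 0)
  have := intervalIntegral.integral_comp_mul_sub (a := node n i) (b := node n (i + 1))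
    (fun y : ℝ => α + β * (y : ℂ) + δ * (y : ℂ) ^ 2) hn0 i
  rw [this, mul_node hn, mul_node hn, sub_self]
  push_cast
  rw [add_sub_cancel_left]
  have hderiv : ∀ y : ℝ, HasDerivAt (fun y : ℝ => α * (y : ℂ) + β / 2 * (y : ℂ) ^ 2 +
      δ / 3 * (y : ℂ) ^ 3) (α + β * (y : ℂ) + δ * (y : ℂ) ^ 2) y := by
    intro y
    have h1 : HasDerivAt (fun y : ℝ => (y : ℂ)) 1 y := by
      simpa using (hasDerivAt_id y).ofReal_comp
    have h2 := ((h1.const_mul α).add ((h1.pow 2).const_mul (β / 2))).add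
      ((h1.pow 3).const_mul (δ / 3))
    exact h2.congr_deriv (by push_cast; ring)
  rw [intervalIntegral.integral_eq_sub_of_hasDerivAt (fun y _ => hderiv y)
    (Continuous.intervalIntegrable (by fun_prop) _ _)]
  rw [Complex.real_smul]
  push_cast; ring

theorem l2Inner_of_hasNodal {n : ℕ} (hn : 1 ≤ n) {u v : ℝ → ℂ} {U V : ℕ → ℂ}
    (hu : HasNodal n u U) (hv : HasNodal n v V) :
    l2Inner u v = (6 * n : ℂ)⁻¹ * ∑ i ∈ Finset.range n,
      (2 * U i * (starRingEnd ℂ) (V i) + U i * (starRingEnd ℂ) (V (i + 1)) +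
        U (i + 1) * (starRingEnd ℂ) (V i) + 2 * U (i + 1) * (starRingEnd ℂ) (V (i + 1))) := by
  rw [l2Inner, integral_vol_eq_sum hn
    (G := fun i x => cellAffine n U i x * (starRingEnd ℂ) (cellAffine n V i x)), Finset.mul_sum]
  · refine Finset.sum_congr rfl fun i _ => ?_
    have := integral_cell_quadratic hn i (U i * (starRingEnd ℂ) (V i))
      (U i * (starRingEnd ℂ) (V (i + 1) - V i) + (U (i + 1) - U i) * (starRingEnd ℂ) (V i))
      ((U (i + 1) - U i) * (starRingEnd ℂ) (V (i + 1) - V i))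
    have e : (fun x : ℝ => cellAffine n U i x * (starRingEnd ℂ) (cellAffine n V i x)) =
      fun x : ℝ => U i * (starRingEnd ℂ) (V i) +
        (U i * (starRingEnd ℂ) (V (i + 1) - V i) + (U (i + 1) - U i) * (starRingEnd ℂ) (V i)) *
          ((n * x - i : ℝ) : ℂ) +
        ((U (i + 1) - U i) * (starRingEnd ℂ) (V (i + 1) - V i)) * ((n * x - i : ℝ) : ℂ) ^ 2 := by
      funext x
      simp only [cellAffine, map_add, map_mul, Complex.conj_ofReal]
      ring
    rw [e, this]
    simp only [map_sub]
    rw [mul_inv]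
    ring
  · intro i
    exact (continuous_cellAffine n U i).mul
      (Complex.continuous_conj.comp (continuous_cellAffine n V i))
  · intro i hi x hx
    simp only [hu i hi x (Ioo_subset_Icc_self hx), hv i hi x (Ioo_subset_Icc_self hx)]

theorem l2Inner_deriv_of_hasNodal {n : ℕ} (hn : 1 ≤ n) {u v : ℝ → ℂ} {U V : ℕ → ℂ}
    (hu : HasNodal n u U) (hv : HasNodal n v V) :
    l2Inner (deriv u) (deriv v) = n * ∑ i ∈ Finset.range n,
      (U (i + 1) - U i) * (starRingEnd ℂ) (V (i + 1) - V i) := by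
  rw [l2Inner, integral_vol_eq_sum hn (G := fun i _ => n * (U (i + 1) - U i) *
    (starRingEnd ℂ) (n * (V (i + 1) - V i))) (fun _ => continuous_const), Finset.mul_sum]
  · refine Finset.sum_congr rfl fun i _ => ?_
    have h := integral_cell_quadratic hn i (n * (U (i + 1) - U i) *
      (starRingEnd ℂ) (n * (V (i + 1) - V i))) 0 0
    simp only [zero_mul, add_zero, zero_div] at h
    have hn0 : (n : ℂ) ≠ 0 := by exact_mod_cast (by omega : n ≠ 0)
    rw [h, map_mul, Complex.conj_natCast]
    field_simp
  · intro i hi x hx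
    simp only [(hu.hasDerivAt hi hx).deriv, (hv.hasDerivAt hi hx).deriv]

/-! ### Conformity: interpolants belong to the finite element space. -/

instance isProbabilityMeasure_vol : IsProbabilityMeasure vol := ⟨by simp⟩

/-- Almost every point of `(0,1)` lies in an open cell. -/
theorem ae_mem_open_cell {n : ℕ} (hn : 1 ≤ n) :
    ∀ᵐ x ∂vol, ∃ i < n, x ∈ Ioo (node n i) (node n (i + 1)) := by
  have h1 : ∀ᵐ x ∂vol, x ∉ range (node n) :=
    measure_eq_zero_iff_ae_notMem.1 ((countable_range (node n)).measure_zero vol)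
  filter_upwards [h1, ae_restrict_mem measurableSet_Ioo] with x hx hx'
  obtain ⟨i, hi, hxi⟩ := exists_mem_cell hn (Ioo_subset_Icc_self hx')
  refine ⟨i, hi, lt_of_le_of_ne hxi.1 ?_, lt_of_le_of_ne hxi.2 ?_⟩
  · rintro rfl; exact hx ⟨_, rfl⟩
  · rintro rfl; exact hx ⟨_, rfl⟩

theorem HasNodal.norm_deriv_le {n : ℕ} (hn : 1 ≤ n) {v : ℝ → ℂ} {V : ℕ → ℂ}
    (hv : HasNodal n v V) {M : ℝ} (hM : ∀ i < n, ‖n * (V (i + 1) - V i)‖ ≤ M) :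
    ∀ᵐ x ∂vol, ‖deriv v x‖ ≤ M := by
  filter_upwards [ae_mem_open_cell hn] with x ⟨i, hi, hx⟩
  rw [(hv.hasDerivAt hi hx).deriv]
  exact hM i hi

theorem HasNodal.memLp_deriv {n : ℕ} (hn : 1 ≤ n) {v : ℝ → ℂ} {V : ℕ → ℂ}
    (hv : HasNodal n v V) : MemLp (deriv v) 2 vol := by
  refine MemLp.of_bound (measurable_deriv v).aestronglyMeasurable
    (∑ i ∈ Finset.range n, ‖n * (V (i + 1) - V i)‖) (hv.norm_deriv_le hn fun i hi => ?_)
  exact Finset.single_le_sum (f := fun i => ‖n * (V (i + 1) - V i)‖) (fun _ _ => norm_nonneg _)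
    (Finset.mem_range.2 hi)

theorem memLp_of_continuous {v : ℝ → ℂ} (hv : Continuous v) : MemLp v 2 vol := by
  obtain ⟨M, hM⟩ := (isCompact_Icc (a := (0 : ℝ)) (b := 1)).exists_bound_of_continuousOn
    hv.continuousOn
  refine MemLp.of_bound hv.aestronglyMeasurable M ?_
  filter_upwards [ae_restrict_mem measurableSet_Ioo] with x hx
  exact hM x (Ioo_subset_Icc_self hx)

/-- The classical derivative of a continuous piecewise affine function is its weak derivative. -/
theorem HasNodal.isWeakDeriv {n : ℕ} (hn : 1 ≤ n) {v : ℝ → ℂ} {V : ℕ → ℂ}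
    (hv : HasNodal n v V) (hc : Continuous v) : IsWeakDeriv v (deriv v) := by
  intro φ hφ _ hsupp
  have hφ1 : ContDiff ℝ 1 φ := hφ.of_le (by exact_mod_cast le_top)
  have hφ' : Continuous (deriv φ) := hφ1.continuous_deriv le_rfl
  have hφd : Differentiable ℝ φ := hφ1.differentiable one_ne_zero
  have hzero : ∀ x, x ∉ Ioo (0 : ℝ) 1 → φ x = 0 := fun x hx =>
    image_eq_zero_of_notMem_tsupport fun h => hx (hsupp h)
  have i1 : Integrable (fun x => v x * deriv φ x) vol :=
    (memLp_of_continuous hc).integrable_mul (memLp_of_continuous hφ')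
  have i2 : Integrable (fun x => deriv v x * φ x) vol :=
    (hv.memLp_deriv hn).integrable_mul (memLp_of_continuous hφ.continuous)
  have key : ∫ x in (0 : ℝ)..1, (deriv v x * φ x + v x * deriv φ x) = v 1 * φ 1 - v 0 * φ 0 := by
    refine integral_eq_of_hasDerivAt_off_countable_of_le (fun x => v x * φ x) _ zero_le_one
      (countable_range (node n)) (hc.mul hφ.continuous).continuousOn ?_ ?_
    · rintro x ⟨hx, hxn⟩
      obtain ⟨i, hi, hxi⟩ := exists_mem_cell hn (Ioo_subset_Icc_self hx)
      have hx' : x ∈ Ioo (node n i) (node n (i + 1)) := by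
        refine ⟨lt_of_le_of_ne hxi.1 ?_, lt_of_le_of_ne hxi.2 ?_⟩
        · rintro rfl; exact hxn ⟨_, rfl⟩
        · rintro rfl; exact hxn ⟨_, rfl⟩
      exact (hv.hasDerivAt hi hx').differentiableAt.hasDerivAt.mul (hφd x).hasDerivAt
    · rw [intervalIntegrable_iff_integrableOn_Ioo_of_le zero_le_one]
      exact i2.add i1
  rw [← integral_vol, integral_add i2 i1, hzero 0 (by simp), hzero 1 (by simp), mul_zero,
    mul_zero, sub_zero] at key
  linear_combination key

theorem interp_mem {n : ℕ} (hn : 1 ≤ n) {V : ℕ → ℂ} (hV : V 0 = 0) : interp n V ∈ femSpace n := by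
  have hc := continuous_interp n V
  have hN := hasNodal_interp hn V
  refine ⟨⟨memLp_of_continuous hc, _, hN.memLp_deriv hn, hN.isWeakDeriv hn hc⟩, hc.continuousOn,
    ?_, fun i hi => ⟨V i - (V (i + 1) - V i) * i, (V (i + 1) - V i) * n, fun x hx => ?_⟩⟩
  · rw [← node_zero n, hN.apply_node hn (Nat.zero_le n), hV]
  · rw [hN i hi x (Ioo_subset_Icc_self hx), cellAffine]
    push_cast; ring

/-! ### Loads and the energy norm. -/

/-- The load of the data `f` at the node number `j + 1`. -/
noncomputable def load (n : ℕ) (f : ℝ → ℂ) (j : ℕ) : ℂ := ∫ x, f x * hat n (j + 1) x ∂vol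

theorem integrable_mul_hat {f : ℝ → ℂ} (hf : MemLp f 2 vol) (n j : ℕ) :
    Integrable (fun x => f x * hat n j x) vol :=
  hf.integrable_mul (memLp_of_continuous (Complex.continuous_ofReal.comp (continuous_hat n j)))

theorem l2Inner_eq_sum_load {n : ℕ} (hn : 1 ≤ n) {f v : ℝ → ℂ} (hf : MemLp f 2 vol) {V : ℕ → ℂ}
    (hv : HasNodal n v V) (hV : V 0 = 0) :
    l2Inner f v = ∑ j ∈ Finset.range n, load n f j * (starRingEnd ℂ) (V (j + 1)) := by
  have h1 : l2Inner f v = ∫ x, ∑ j ∈ Finset.range n,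
      (f x * hat n (j + 1) x) * (starRingEnd ℂ) (V (j + 1)) ∂vol := by
    refine integral_congr_ae ?_
    filter_upwards [ae_restrict_mem measurableSet_Ioo] with x hx
    rw [hv.eqOn hn (hasNodal_interp hn V) (Ioo_subset_Icc_self hx), interp, map_sum,
      Finset.sum_range_succ', hV, zero_mul, map_zero, add_zero, Finset.mul_sum]
    refine Finset.sum_congr rfl fun j _ => ?_
    rw [map_mul, Complex.conj_ofReal]; ring
  rw [h1, integral_finsetSum _ fun j _ => (integrable_mul_hat hf n _).mul_const _]
  refine Finset.sum_congr rfl fun j _ => ?_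
  rw [integral_mul_const, load]

/-- Nonnegativity of the variance of ‖f‖ for a probability measure. -/
theorem integral_norm_le_l2Norm {f : ℝ → ℂ} (hf : MemLp f 2 vol) :
    ∫ x, ‖f x‖ ∂vol ≤ l2Norm f := by
  refine Real.le_sqrt_of_sq_le ?_
  have i1 : Integrable (fun x => ‖f x‖) vol := (hf.integrable one_le_two).norm
  have i2 : Integrable (fun x => ‖f x‖ ^ 2) vol := hf.integrable_norm_pow two_ne_zero
  set m := ∫ x, ‖f x‖ ∂vol
  calc m ^ 2 = ∫ x, (2 * m * ‖f x‖ - m ^ 2) ∂vol := by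
        rw [integral_sub (i1.const_mul _) (integrable_const _), integral_const_mul]
        simp; ring
    _ ≤ _ := integral_mono ((i1.const_mul _).sub (integrable_const _)) i2
        fun x => by nlinarith [sq_nonneg (‖f x‖ - m)]

/-- The hat functions of the nodes 1, …, n sum to at most one, so the ℓ¹ norm of the loads costs no
power of n. -/
theorem sum_norm_load_le {n : ℕ} (hn : 1 ≤ n) {f : ℝ → ℂ} (hf : MemLp f 2 vol) :
    ∑ j ∈ Finset.range n, ‖load n f j‖ ≤ l2Norm f := by
  have i1 : Integrable (fun x => ‖f x‖) vol := (hf.integrable one_le_two).norm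
  calc ∑ j ∈ Finset.range n, ‖load n f j‖
      ≤ ∑ j ∈ Finset.range n, ∫ x, ‖f x * hat n (j + 1) x‖ ∂vol :=
        Finset.sum_le_sum fun j _ => norm_integral_le_integral_norm _
    _ = ∫ x, ∑ j ∈ Finset.range n, ‖f x * hat n (j + 1) x‖ ∂vol :=
        (integral_finsetSum _ fun j _ => (integrable_mul_hat hf n _).norm).symm
    _ ≤ ∫ x, ‖f x‖ ∂vol := by
        refine integral_mono_ae (integrable_finsetSum _ fun j _ =>
          (integrable_mul_hat hf n _).norm) i1 ?_
        filter_upwards [ae_mem_open_cell hn] with x ⟨i, hi, hx⟩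
        have h1 := sum_hat hn (fun _ => 1) hi (Ioo_subset_Icc_self hx)
        simp only [one_mul, cellAffine, sub_self, zero_mul, add_zero] at h1
        have h2 : ∑ j ∈ Finset.range (n + 1), hat n j x = 1 := by exact_mod_cast h1
        rw [Finset.sum_range_succ'] at h2
        have h3 : ∀ j, ‖f x * hat n (j + 1) x‖ = ‖f x‖ * hat n (j + 1) x := fun j => by
          rw [norm_mul, Complex.norm_real, Real.norm_of_nonneg (hat_nonneg _ _ _)]
        simp only [h3]
        rw [← Finset.mul_sum]
        exact mul_le_of_le_one_right (norm_nonneg _) (by linarith [hat_nonneg n 0 x])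
    _ ≤ l2Norm f := integral_norm_le_l2Norm hf

/-- The energy norm of a piecewise affine function with slopes bounded by `M`. -/
theorem energyNorm_le {n : ℕ} (hn : 1 ≤ n) {γ M : ℝ} (hγ : |γ| ≤ 1 / 6) {v : ℝ → ℂ} {V : ℕ → ℂ}
    (hv : HasNodal n v V) (hM0 : 0 ≤ M) (hM : ∀ i < n, ‖n * (V (i + 1) - V i)‖ ≤ M) :
    energyNorm n (γ : ℂ) v ≤ 2 * M := by
  refine Real.sqrt_le_iff.2 ⟨by positivity, ?_⟩
  have hn0 : (0 : ℝ) < n := by exact_mod_cast hn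
  have h1 : l2Norm (deriv v) ^ 2 ≤ M ^ 2 := by
    rw [l2Norm, Real.sq_sqrt (integral_nonneg fun x => by positivity)]
    have : ∫ x, ‖deriv v x‖ ^ 2 ∂vol ≤ ∫ _x, M ^ 2 ∂vol := by
      refine integral_mono_of_nonneg (ae_of_all _ fun x => by positivity) (integrable_const _) ?_
      filter_upwards [hv.norm_deriv_le hn hM] with x hx
      gcongr
    simpa using this
  have h2 : ∀ j ∈ Finset.Icc 1 (n - 1), ‖(γ : ℂ)‖ * meshSize n * ‖jump n (deriv v) j‖ ^ 2 ≤
      1 / n * M ^ 2 := by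
    intro j hj
    rw [Finset.mem_Icc] at hj
    obtain ⟨i, rfl⟩ : ∃ i, j = i + 1 := ⟨j - 1, by omega⟩
    have hjump : ‖jump n (deriv v) (i + 1)‖ ≤ 2 * M := by
      rw [hv.jump_deriv hn (by omega)]
      have e : (n : ℂ) * (2 * V (i + 1) - V i - V (i + 2)) =
        n * (V (i + 1) - V i) - n * (V (i + 1 + 1) - V (i + 1)) := by ring
      rw [e]
      exact (norm_sub_le _ _).trans (by linarith [hM i (by omega), hM (i + 1) (by omega)])
    rw [Complex.norm_real, Real.norm_eq_abs, meshSize]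
    calc |γ| * (1 / n) * ‖jump n (deriv v) (i + 1)‖ ^ 2 ≤ 1 / 6 * (1 / n) * (2 * M) ^ 2 := by
          gcongr
      _ = 4 / 6 * (1 / n * M ^ 2) := by ring
      _ ≤ 1 / n * M ^ 2 := mul_le_of_le_one_left (by positivity) (by norm_num)
  have h3 := Finset.sum_le_sum h2
  rw [Finset.sum_const, Nat.card_Icc, nsmul_eq_mul] at h3
  have h4 : ((n - 1 + 1 - 1 : ℕ) : ℝ) * (1 / n * M ^ 2) ≤ n * (1 / n * M ^ 2) := by
    gcongr; omega
  have h5 : n * (1 / n * M ^ 2) = M ^ 2 := by field_simp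
  nlinarith [sq_nonneg M]

/-! ### Summation by parts and the rows of the form. -/

theorem sum_stiffness_by_parts {U V : ℕ → ℂ} (hV : V 0 = 0) (m : ℕ) :
    ∑ j ∈ Finset.range m, (U (j + 1) - U j) * (V (j + 1) - V j) =
      ∑ i ∈ Finset.range m, (2 * U (i + 1) - U i - U (i + 2)) * V (i + 1) +
        (U (m + 1) - U m) * V m := by
  induction m with
  | zero => simp [hV]
  | succ m ih => rw [Finset.sum_range_succ, Finset.sum_range_succ, ih]; ring

theorem sum_mass_by_parts {U V : ℕ → ℂ} (hV : V 0 = 0) (m : ℕ) :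
    ∑ j ∈ Finset.range m, (2 * U j * V j + U j * V (j + 1) + U (j + 1) * V j +
        2 * U (j + 1) * V (j + 1)) =
      ∑ i ∈ Finset.range m, (U i + 4 * U (i + 1) + U (i + 2)) * V (i + 1) -
        (2 * U m + U (m + 1)) * V m := by
  induction m with
  | zero => simp [hV]
  | succ m ih => rw [Finset.sum_range_succ, Finset.sum_range_succ, ih]; ring

theorem sum_penalty_by_parts {Q V : ℕ → ℂ} (hQ : Q 0 = 0) (hV : V 0 = 0) (m : ℕ) :
    ∑ i ∈ Finset.range m, Q (i + 1) * (2 * V (i + 1) - V i - V (i + 2)) =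
      ∑ i ∈ Finset.range m, (2 * Q (i + 1) - Q i - Q (i + 2)) * V (i + 1) -
        (Q m * (V (m + 1) - V m) - V m * (Q (m + 1) - Q m)) := by
  induction m with
  | zero => simp [hV, hQ]
  | succ m ih => rw [Finset.sum_range_succ, Finset.sum_range_succ, ih]; ring

theorem sum_Icc_one (m : ℕ) (g : ℕ → ℂ) :
    ∑ j ∈ Finset.Icc 1 m, g j = ∑ i ∈ Finset.range m, g (i + 1) := by
  refine Finset.sum_nbij' (fun j => j - 1) (fun i => i + 1) ?_ ?_ ?_ ?_ ?_ <;>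
    simp only [Finset.mem_Icc, Finset.mem_range] <;> intro j hj
  · omega
  · omega
  · omega
  · omega
  · congr 1; omega

/-- The form of two finite element functions, tested row by row. -/
theorem form_eq_sum {n : ℕ} (hn : 1 ≤ n) {k γ t : ℝ} (ht : k = n * t) {u v : ℝ → ℂ}
    {U Q V : ℕ → ℂ} (hu : HasNodal n u U) (hv : HasNodal n v V) (hV0 : V 0 = 0)
    (hQ0 : Q 0 = 0) (hQ : ∀ i < n, Q (i + 1) = 2 * U (i + 1) - U i - U (i + 2))
    (hUn : U (n + 1) = (1 + Complex.I * t) * U n)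
    (hQn : γ * (Q (n + 1) - (1 + Complex.I * t) * Q n) = -(t ^ 2 / 6) * (2 * U n + U (n + 1))) :
    form n k γ u v = n * ∑ i ∈ Finset.range n,
      (Q (i + 1) - t ^ 2 / 6 * (U i + 4 * U (i + 1) + U (i + 2)) +
        γ * (2 * Q (i + 1) - Q i - Q (i + 2))) * (starRingEnd ℂ) (V (i + 1)) := by
  have hn0 : (n : ℂ) ≠ 0 := by exact_mod_cast (by omega : n ≠ 0)
  -- The ghost factor 1 + it is not conjugated, because the penalty tests with v̄'(1) − ik v̄(1).
  -- Thus the end term of the penalty becomes one more second difference, at the node n.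
  obtain ⟨Z, hZ⟩ : ∃ Z : ℕ → ℂ, ∀ j, Z j = if j ≤ n then (starRingEnd ℂ) (V j) else
    (1 + Complex.I * t) * (starRingEnd ℂ) (V n) := ⟨_, fun _ => rfl⟩
  have hZV : ∀ j ≤ n, (starRingEnd ℂ) (V j) = Z j := fun j hj => by rw [hZ, if_pos hj]
  have hZn : Z (n + 1) = (1 + Complex.I * t) * Z n := by
    rw [hZ, if_neg (by omega), hZV n le_rfl]
  have hZ0 : Z 0 = 0 := by rw [← hZV 0 (by omega), hV0, map_zero]
  have hS : l2Inner (deriv u) (deriv v) = n * (∑ i ∈ Finset.range n, Q (i + 1) * Z (i + 1) +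
      (U (n + 1) - U n) * Z n) := by
    have e := sum_stiffness_by_parts (U := U) hZ0 n
    have e' : ∑ i ∈ Finset.range n, Q (i + 1) * Z (i + 1) =
        ∑ i ∈ Finset.range n, (2 * U (i + 1) - U i - U (i + 2)) * Z (i + 1) :=
      Finset.sum_congr rfl fun i hi => by rw [hQ i (Finset.mem_range.1 hi)]
    rw [l2Inner_deriv_of_hasNodal hn hu hv, e', ← e]
    congr 1
    refine Finset.sum_congr rfl fun i hi => ?_
    have hi := Finset.mem_range.1 hi
    rw [map_sub, hZV _ hi, hZV _ hi.le]
  have hM : l2Inner u v = (6 * n : ℂ)⁻¹ * (∑ i ∈ Finset.range n,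
      (U i + 4 * U (i + 1) + U (i + 2)) * Z (i + 1) - (2 * U n + U (n + 1)) * Z n) := by
    rw [l2Inner_of_hasNodal hn hu hv, ← sum_mass_by_parts hZ0 n]
    congr 1
    refine Finset.sum_congr rfl fun i hi => ?_
    have hi := Finset.mem_range.1 hi
    rw [hZV _ hi, hZV _ hi.le]
  have hP : penalty n k γ u v = γ * n * (∑ i ∈ Finset.range n,
      (2 * Q (i + 1) - Q i - Q (i + 2)) * Z (i + 1) -
        (Q n * (Z (n + 1) - Z n) - Z n * (Q (n + 1) - Q n))) := by
    rw [← sum_penalty_by_parts hQ0 hZ0 n, penalty, hu.derivAtOne_eq hn, hv.derivAtOne_eq hn,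
      hu.apply_one hn, hv.apply_one hn, sum_Icc_one]
    have hmesh : (meshSize n : ℂ) = (n : ℂ)⁻¹ := by simp [meshSize]
    have hk : (k : ℂ) = n * t := by rw [ht]; push_cast; ring
    obtain ⟨m, rfl⟩ : ∃ m, n = m + 1 := ⟨n - 1, by omega⟩
    rw [Finset.sum_range_succ, mul_add, Finset.mul_sum, Nat.add_sub_cancel]
    congr 1
    · refine Finset.sum_congr rfl fun i hi => ?_
      have hi := Finset.mem_range.1 hi
      rw [hu.jump_deriv hn (by omega), hv.jump_deriv hn (by omega), ← hQ i (by omega), hmesh]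
      simp only [map_mul, map_sub, Complex.conj_natCast, Complex.conj_ofNat]
      rw [hZV _ (by omega), hZV _ (by omega), hZV _ (by omega)]
      field_simp
    · have h1 := hQ m (by omega)
      rw [show m + 2 = m + 1 + 1 from rfl, hUn] at h1
      rw [show m + 2 = m + 1 + 1 from rfl, hZn, h1, hmesh, hk]
      simp only [map_mul, map_sub, Complex.conj_natCast]
      rw [hZV _ le_rfl, hZV _ (by omega)]
      field_simp
      ring
  have hR : ∑ i ∈ Finset.range n, (Q (i + 1) - t ^ 2 / 6 * (U i + 4 * U (i + 1) + U (i + 2)) +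
        γ * (2 * Q (i + 1) - Q i - Q (i + 2))) * (starRingEnd ℂ) (V (i + 1)) =
      ∑ i ∈ Finset.range n, Q (i + 1) * Z (i + 1) - t ^ 2 / 6 *
        ∑ i ∈ Finset.range n, (U i + 4 * U (i + 1) + U (i + 2)) * Z (i + 1) +
      γ * ∑ i ∈ Finset.range n, (2 * Q (i + 1) - Q i - Q (i + 2)) * Z (i + 1) := by
    rw [Finset.mul_sum, Finset.mul_sum, ← Finset.sum_sub_distrib, ← Finset.sum_add_distrib]
    refine Finset.sum_congr rfl fun i hi => ?_
    rw [hZV _ (Finset.mem_range.1 hi)]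
    ring
  have hk : (k : ℂ) = n * t := by rw [ht]; push_cast; ring
  rw [hR, form, hS, hM, hP, hu.apply_one hn, hv.apply_one hn, hZV n le_rfl, hUn, hZn, hk]
  rw [hUn] at hQn
  have e : ∀ X : ℂ, ((n : ℂ) * t) ^ 2 * ((6 * n : ℂ)⁻¹ * X) = n * (t ^ 2 / 6) * X := by
    intro X; field_simp
  rw [e]
  -- The stiffness end term cancels the impedance term; those of mass and penalty cancel by the
  -- choice of Q(n+1).
  linear_combination n * Z n * hQn

/-! ### The linear system and its equivalence with the method. -/

/-- The nodal values with unknowns `x` at the nodes `1, …, n`, and the value at the node `0` zero. -/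
def nodal (n : ℕ) (x : Fin n → ℂ) : ℕ → ℂ
  | 0 => 0
  | j + 1 => if h : j < n then x ⟨j, h⟩ else 0

/-- The nodal values extended past the right end by the impedance condition. -/
noncomputable def extNodal (n : ℕ) (t : ℝ) (x : Fin n → ℂ) (j : ℕ) : ℂ :=
  if j ≤ n then nodal n x j else (1 + Complex.I * t) * nodal n x n

/-- The second differences, with the ghost value at the node `n + 1` that makes the last row of the
scheme an interior row. -/
noncomputable def extDiff (n : ℕ) (t γ : ℝ) (x : Fin n → ℂ) : ℕ → ℂ
  | 0 => 0
  | j + 1 =>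
    if j < n then 2 * extNodal n t x (j + 1) - extNodal n t x j - extNodal n t x (j + 2)
    else (1 + Complex.I * t) *
        (2 * extNodal n t x n - extNodal n t x (n - 1) - extNodal n t x (n + 1)) -
      t ^ 2 / (6 * γ) * (2 * extNodal n t x n + extNodal n t x (n + 1))

theorem nodal_add (n : ℕ) (x y : Fin n → ℂ) (j : ℕ) :
    nodal n (x + y) j = nodal n x j + nodal n y j := by
  cases j with
  | zero => simp [nodal]
  | succ j => simp only [nodal]; split_ifs <;> simp

theorem nodal_smul (n : ℕ) (c : ℂ) (x : Fin n → ℂ) (j : ℕ) :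
    nodal n (c • x) j = c * nodal n x j := by
  cases j with
  | zero => simp [nodal]
  | succ j => simp only [nodal]; split_ifs <;> simp

theorem extNodal_add (n : ℕ) (t : ℝ) (x y : Fin n → ℂ) (j : ℕ) :
    extNodal n t (x + y) j = extNodal n t x j + extNodal n t y j := by
  simp only [extNodal, nodal_add]; split_ifs <;> ring

theorem extNodal_smul (n : ℕ) (t : ℝ) (c : ℂ) (x : Fin n → ℂ) (j : ℕ) :
    extNodal n t (c • x) j = c * extNodal n t x j := by
  simp only [extNodal, nodal_smul]; split_ifs <;> ring

theorem extDiff_add (n : ℕ) (t γ : ℝ) (x y : Fin n → ℂ) (j : ℕ) :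
    extDiff n t γ (x + y) j = extDiff n t γ x j + extDiff n t γ y j := by
  cases j with
  | zero => simp [extDiff]
  | succ j => simp only [extDiff, extNodal_add]; split_ifs <;> ring

theorem extDiff_smul (n : ℕ) (t γ : ℝ) (c : ℂ) (x : Fin n → ℂ) (j : ℕ) :
    extDiff n t γ (c • x) j = c * extDiff n t γ x j := by
  cases j with
  | zero => simp [extDiff]
  | succ j => simp only [extDiff, extNodal_smul]; split_ifs <;> ring

theorem extNodal_succ (n : ℕ) (t : ℝ) (x : Fin n → ℂ) :
    extNodal n t x (n + 1) = (1 + Complex.I * t) * extNodal n t x n := by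
  simp [extNodal]

theorem extNodal_fin {n : ℕ} (t : ℝ) (x : Fin n → ℂ) (i : Fin n) :
    extNodal n t x (i + 1) = x i := by
  have : (i : ℕ) + 1 ≤ n := i.2
  simp [extNodal, this, nodal]

theorem extNodal_zero (n : ℕ) (t : ℝ) (x : Fin n → ℂ) : extNodal n t x 0 = 0 := by
  simp [extNodal, nodal]

theorem extDiff_of_lt {n : ℕ} (t γ : ℝ) (x : Fin n → ℂ) {i : ℕ} (hi : i < n) :
    extDiff n t γ x (i + 1) =
      2 * extNodal n t x (i + 1) - extNodal n t x i - extNodal n t x (i + 2) := by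
  simp [extDiff, hi]

theorem extDiff_succ {n : ℕ} (hn : 1 ≤ n) (t : ℝ) {γ : ℝ} (hγ : γ ≠ 0) (x : Fin n → ℂ) :
    γ * (extDiff n t γ x (n + 1) - (1 + Complex.I * t) * extDiff n t γ x n) =
      -(t ^ 2 / 6) * (2 * extNodal n t x n + extNodal n t x (n + 1)) := by
  have hγ' : (γ : ℂ) ≠ 0 := by exact_mod_cast hγ
  have h1 : extDiff n t γ x n =
      2 * extNodal n t x n - extNodal n t x (n - 1) - extNodal n t x (n + 1) := by
    have := extDiff_of_lt t γ x (i := n - 1) (by omega)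
    rwa [show n - 1 + 1 = n by omega, show n - 1 + 2 = n + 1 by omega] at this
  rw [h1]
  simp only [extDiff, lt_irrefl, if_false]
  field_simp
  ring

/-- The matrix of the scheme. -/
noncomputable def scheme (n : ℕ) (t γ : ℝ) : (Fin n → ℂ) →ₗ[ℂ] (Fin n → ℂ) where
  toFun x i := extDiff n t γ x (i + 1) -
    t ^ 2 / 6 * (extNodal n t x i + 4 * extNodal n t x (i + 1) + extNodal n t x (i + 2)) +
    γ * (2 * extDiff n t γ x (i + 1) - extDiff n t γ x i - extDiff n t γ x (i + 2))
  map_add' x y := by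
    funext i
    simp only [extDiff_add, extNodal_add, Pi.add_apply]; ring
  map_smul' c x := by
    funext i
    simp only [extDiff_smul, extNodal_smul, Pi.smul_apply, smul_eq_mul, RingHom.id_apply]; ring

/-- Stability of the scheme. -/
theorem norm_extNodal_sub_le {n : ℕ} {t γ : ℝ} (hn : 1 ≤ n) (ht : 0 < t) (ht1 : t ≤ 1)
    (hγ0 : γ ≠ 0) (hγ : |γ| ≤ 1 / 6) (x : Fin n → ℂ) {i : ℕ} (hi : i < n) :
    ‖extNodal n t x (i + 1) - extNodal n t x i‖ ≤ 200 * ∑ j, ‖scheme n t γ x j‖ := by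
  have := scheme_bound (G := fun i => if h : i < n then scheme n t γ x ⟨i, h⟩ else 0) hn ht ht1
    hγ0 hγ (extNodal_zero n t x) rfl (fun i hi => extDiff_of_lt t γ x hi)
    (fun i hi => by simp [hi, scheme]) (extNodal_succ n t x) (extDiff_succ hn t hγ0 x) i hi
  rw [Finset.sum_range] at this
  simpa using this

/-- Zero data make every increment vanish, and the value at the node 0 is zero. -/
theorem scheme_injective {n : ℕ} {t γ : ℝ} (hn : 1 ≤ n) (ht : 0 < t) (ht1 : t ≤ 1)
    (hγ0 : γ ≠ 0) (hγ : |γ| ≤ 1 / 6) : Function.Injective (scheme n t γ) := by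
  rw [injective_iff_map_eq_zero]
  intro x hx
  have h : ∀ j ≤ n, extNodal n t x j = 0 := by
    intro j
    induction j with
    | zero => intro _; exact extNodal_zero n t x
    | succ j ih =>
      intro hj
      have := norm_extNodal_sub_le hn ht ht1 hγ0 hγ x (i := j) hj
      rw [ih (by omega), hx] at this
      simpa using this
  funext i
  rw [← extNodal_fin t x i, h _ i.2, Pi.zero_apply]

theorem exists_hasNodal_extNodal {n : ℕ} (hn : 1 ≤ n) (t : ℝ) {v : ℝ → ℂ} (hv : v ∈ femSpace n) :
    ∃ x : Fin n → ℂ, HasNodal n v (extNodal n t x) := by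
  refine ⟨fun i => v (node n (i + 1)), fun i hi y hy => ?_⟩
  have h : ∀ j ≤ n, extNodal n t (fun i : Fin n => v (node n (i + 1))) j = v (node n j) := by
    intro j hj
    cases j with
    | zero => rw [extNodal_zero, node_zero, hv.2.2.1]
    | succ j => exact extNodal_fin t _ ⟨j, hj⟩
  rw [hasNodal_of_mem hn hv i hi y hy, cellAffine, cellAffine, h _ hi.le, h _ hi]

/-- A finite element function solves the CIP-FEM if and only if its nodal values solve the
scheme. -/
theorem isSolution_iff {n : ℕ} {k γ t : ℝ} (hn : 1 ≤ n) (hk : k = n * t) (hγ : γ ≠ 0)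
    {f u : ℝ → ℂ} (hf : MemLp f 2 vol) (hu : u ∈ femSpace n) {x : Fin n → ℂ}
    (hx : HasNodal n u (extNodal n t x)) :
    IsSolution n k γ f u ↔ ∀ i : Fin n, n * scheme n t γ x i = load n f i := by
  have hform : ∀ {v : ℝ → ℂ} {V : ℕ → ℂ}, HasNodal n v V → V 0 = 0 →
      form n k γ u v = ∑ i : Fin n, n * scheme n t γ x i * (starRingEnd ℂ) (V (i + 1)) := by
    intro v V hv hV
    rw [form_eq_sum hn hk hx hv hV (Q := extDiff n t γ x) rfl
      (fun i hi => extDiff_of_lt t γ x hi) (extNodal_succ n t x) (extDiff_succ hn t hγ x),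
      Finset.sum_range, Finset.mul_sum]
    exact Finset.sum_congr rfl fun i _ => (mul_assoc _ _ _).symm
  constructor
  · rintro ⟨-, h⟩ i
    have hV : (Pi.single ((i : ℕ) + 1) 1 : ℕ → ℂ) 0 = 0 := by simp
    have hN := hasNodal_interp hn (Pi.single ((i : ℕ) + 1) 1 : ℕ → ℂ)
    have h1 := h _ (interp_mem hn hV)
    rw [hform hN hV, l2Inner_eq_sum_load hn hf hN hV, Finset.sum_range] at h1
    have hs : ∀ j : Fin n, (starRingEnd ℂ) ((Pi.single ((i : ℕ) + 1) 1 : ℕ → ℂ) (j + 1)) =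
        if j = i then 1 else 0 := by
      intro j
      by_cases hji : j = i
      · simp [hji]
      · have : (j : ℕ) + 1 ≠ i + 1 := fun h => hji (Fin.ext (by omega))
        simp [hji, Pi.single_eq_of_ne this]
    simpa only [hs, mul_ite, mul_one, mul_zero, Finset.sum_ite_eq', Finset.mem_univ, if_true]
      using h1
  · refine fun h => ⟨hu, fun v hv => ?_⟩
    have hN := hasNodal_of_mem hn hv
    have hV : v (node n 0) = 0 := by rw [node_zero, hv.2.2.1]
    rw [hform hN hV, l2Inner_eq_sum_load hn hf hN hV, Finset.sum_range]
    exact Finset.sum_congr rfl fun i _ => by rw [h i]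

end CIP

theorem mainTheorem4 :
    ∃ C : ℝ, 0 < C ∧
      ∀ (n : ℕ) (k γ : ℝ), 1 ≤ n → 1 ≤ k → k * CIP.meshSize n ≤ 1 →
        0 < |γ| → |γ| ≤ 1 / 6 →
        ∀ f : ℝ → ℂ, MeasureTheory.MemLp f 2 CIP.vol →
          ∃ u : ℝ → ℂ, CIP.IsSolution n k (γ : ℂ) f u ∧
            (∀ w : ℝ → ℂ, CIP.IsSolution n k (γ : ℂ) f w →
              Set.EqOn w u (Set.Icc 0 1)) ∧
            CIP.energyNorm n (γ : ℂ) u ≤ C * CIP.l2Norm f := by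
  -- 400 = 2 · 200: slopes are at most 200‖f‖, and the energy norm is at most twice the largest
  -- slope.
  refine ⟨400, by norm_num, fun n k γ hn hk hkh hγ0 hγ f hf => ?_⟩
  have hn0 : (0 : ℝ) < n := by exact_mod_cast hn
  have hnc : (n : ℂ) ≠ 0 := by exact_mod_cast hn0.ne'
  obtain ⟨t, ht⟩ : ∃ t : ℝ, t = k * CIP.meshSize n := ⟨_, rfl⟩
  have hkt : k = n * t := by rw [ht, CIP.meshSize]; field_simp
  have ht1 : t ≤ 1 := ht ▸ hkh
  have ht0 : 0 < t := by rw [ht, CIP.meshSize]; positivity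
  have hγ0 : γ ≠ 0 := abs_pos.1 hγ0
  have hinj := CIP.scheme_injective hn ht0 ht1 hγ0 hγ
  obtain ⟨x, hx⟩ := LinearMap.injective_iff_surjective.1 hinj
    fun i : Fin n => (n : ℂ)⁻¹ * CIP.load n f i
  have hrow : ∀ i : Fin n, n * CIP.scheme n t γ x i = CIP.load n f i := fun i => by
    rw [hx, mul_inv_cancel_left₀ hnc]
  have hN := CIP.hasNodal_interp hn (CIP.extNodal n t x)
  have hmem := CIP.interp_mem hn (CIP.extNodal_zero n t x)
  refine ⟨CIP.interp n (CIP.extNodal n t x),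
    (CIP.isSolution_iff hn hkt hγ0 hf hmem hN).2 hrow, fun w hw => ?_, ?_⟩
  · obtain ⟨y, hy⟩ := CIP.exists_hasNodal_extNodal hn t hw.1
    have hyrow := (CIP.isSolution_iff hn hkt hγ0 hf hw.1 hy).1 hw
    have hyx : y = x := hinj (funext fun i => mul_left_cancel₀ hnc (by rw [hyrow, hrow]))
    exact (hyx ▸ hy).eqOn hn hN
  · have hS : n * ∑ j, ‖CIP.scheme n t γ x j‖ ≤ CIP.l2Norm f := by
      refine le_trans (le_of_eq ?_) (CIP.sum_norm_load_le hn hf)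
      rw [Finset.sum_range, Finset.mul_sum]
      refine Finset.sum_congr rfl fun j _ => ?_
      rw [← hrow, norm_mul, Complex.norm_natCast]
    have hE := CIP.energyNorm_le hn hγ hN
      (M := 200 * CIP.l2Norm f) (mul_nonneg (by norm_num) (Real.sqrt_nonneg _)) fun i hi => ?_
    · linarith
    · rw [norm_mul, Complex.norm_natCast]
      calc _ ≤ n * (200 * ∑ j, ‖CIP.scheme n t γ x j‖) :=
            mul_le_mul_of_nonneg_left
              (CIP.norm_extNodal_sub_le hn ht0 ht1 hγ0 hγ x hi) hn0.le
        _ ≤ _ := by linarith
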